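/- Let $n \ge 4$ and let $H$ be a finite simple graph of maximum degree $n+1$ in which exactly one vertex $v$ has degree $n+1$, and such that $H - v$ has maximum degree at most $n-1$. Let $H'$ be the graph obtained from $H$ by an $(n+1)$-subdivision, i.e. by subdividing every edge of $H$ with $n+1$ new vertices (every edge $xy$ is replaced by a path of length $n+2$ with endpoints $x$ and $y$, the inner vertices of the paths being new and pairwise distinct). Let $\square^n K_k$ denote the Cartesian product of $n$ cliques of order $k$: its vertices are the $n$-tuples with entries from a $k$-element set, and two tuples are adjacent if and only if they differ in exactly one coordinate. Then there is an integer $k \ge 2$ such that $\square^n K_k$ is $H'$-induced-saturated; that is, $\square^n K_k$ has no induced subgraph isomorphic to $H'$, but deleting any edge from $\square^n K_k$, or adding to it any edge of its complement, creates an induced copy of $H'$. -/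

import Mathlib

namespace InducedSaturation

/-- The Cartesian product of `n` cliques of order `k`: the vertices are the `n`-tuples with entries
in a `k`-element set, and two tuples are adjacent iff they differ in exactly one coordinate. -/
def cliqueProduct (n k : ℕ) : SimpleGraph (Fin n → Fin k) where
  Adj x y := ∃! i, x i ≠ y i
  symm := ⟨fun _ _ ⟨i, hi, hu⟩ => ⟨i, Ne.symm hi, fun j hj => hu j (Ne.symm hj)⟩⟩
  loopless := ⟨fun _ ⟨_, hi, _⟩ => hi rfl⟩

/-- `G` is `H`-induced-saturated: `G` has no induced subgraph isomorphic to `H`, but deleting any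
edge of `G`, or adding to `G` any edge of its complement, creates an induced copy of `H`. -/
def IsInducedSaturated {W U : Type*} (G : SimpleGraph W) (H : SimpleGraph U) : Prop :=
  ¬ H.IsIndContained G ∧
  (∀ x y, G.Adj x y → H.IsIndContained (G.deleteEdges {s(x, y)})) ∧
  (∀ x y, Gᶜ.Adj x y → H.IsIndContained (G ⊔ SimpleGraph.edge x y))

/-- The vertices `0, 1, …, m + 1` of the path with `m` inner vertices that replaces the edge `e`.
Vertex `0` and all vertices from `m + 1` on are the two endpoints of `e` (listed in an arbitrarily
chosen order); vertex `i + 1` with `i < m` is the `i`-th new vertex belonging to `e`. -/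
noncomputable def pathVertex {V : Type*} (H : SimpleGraph V) (m : ℕ) (e : H.edgeSet) :
    ℕ → V ⊕ (H.edgeSet × Fin m)
  | 0 => Sum.inl (Quot.out e.1).1
  | i + 1 => if h : i < m then Sum.inr (e, ⟨i, h⟩) else Sum.inl (Quot.out e.1).2

/-- The `m`-subdivision of `H`: its vertices are those of `H` together with `m` new vertices for
each edge of `H`, and its edges are those of the paths of length `m + 1` that replace the
edges of `H`. -/
noncomputable def subdivision {V : Type*} (H : SimpleGraph V) (m : ℕ) :
    SimpleGraph (V ⊕ (H.edgeSet × Fin m)) :=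
  SimpleGraph.fromRel fun a b =>
    ∃ e : H.edgeSet, ∃ i ≤ m, a = pathVertex H m e i ∧ b = pathVertex H m e (i + 1)

end InducedSaturation

/-! The neighbours of a tuple fall into `n` cliques, one for each coordinate, so no tuple has `n +
1` pairwise nonadjacent neighbours, whereas `v` has them in the subdivision
(`not_isIndContained_cliqueProduct`).

For saturation, the subdivision is drawn in tuples over the alphabet `V ⊕ (E × Bool)`. A vertex `u`
sits at the constant tuple `u`. An edge becomes a walk of `n + 2` steps: two steps introduce its two
private letters, then `n` steps turn the coordinates one by one into the far end. Inner vertices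
with private letters in two coordinates are far from everything off the walk; next to a vertex of
`H`, the walks stay apart by using distinct coordinates.

At `v` there are `n + 1` edges for `n` coordinates, so one edge `e₁` is exceptional: its first step
changes an arbitrary nonempty set `D` of coordinates. If `D = {i}`, the drawing has exactly one
surplus edge, joining the first inner vertices of `e₁` and of the edge leaving `v` in direction `i`.
If `D` has at least two elements, exactly one edge is missing, the first one of `e₁`
(`Layout.existsUnique_point_iff`). Permuting the alphabet in each coordinate moves this critical
pair onto any pair differing in the coordinates of `D` (`exists_relabel`), which handles deletions
and additions respectively. -/

namespace InducedSaturation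

/-! ### Subdivisions with freely chosen edge directions -/

/-- The `m`-subdivision of a graph with edges `e : E` directed from `a e` to `b e`. -/
def directedSubdivision {V E : Type*} (a b : E → V) (m : ℕ) : SimpleGraph (V ⊕ (E × Fin m)) where
  Adj
    | .inl _, .inl _ => False
    | .inl u, .inr (e, s) => (u = a e ∧ s.1 = 0) ∨ (u = b e ∧ s.1 + 1 = m)
    | .inr (e, s), .inl u => (u = a e ∧ s.1 = 0) ∨ (u = b e ∧ s.1 + 1 = m)
    | .inr (e, s), .inr (f, t) => e = f ∧ (s.1 + 1 = t.1 ∨ t.1 + 1 = s.1)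
  symm := ⟨by
    rintro (u | ⟨e, s⟩) (w | ⟨f, t⟩) h
    · exact h
    · exact h
    · exact h
    · exact ⟨h.1.symm, h.2.symm⟩⟩
  loopless := ⟨by
    rintro (u | ⟨e, s⟩) h
    · exact h
    · rcases h.2 with h | h <;> omega⟩

section directedSubdivision

variable {V E : Type*} (a b : E → V) {m : ℕ}

@[simp]
theorem directedSubdivision_inl_inl (u w : V) :
    ¬ (directedSubdivision a b m).Adj (.inl u) (.inl w) := fun h => h

@[simp]
theorem directedSubdivision_inl_inr (u : V) (e : E) (s : Fin m) :
    (directedSubdivision a b m).Adj (.inl u) (.inr (e, s)) ↔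
      (u = a e ∧ s.1 = 0) ∨ (u = b e ∧ s.1 + 1 = m) := Iff.rfl

@[simp]
theorem directedSubdivision_inr_inl (u : V) (e : E) (s : Fin m) :
    (directedSubdivision a b m).Adj (.inr (e, s)) (.inl u) ↔
      (u = a e ∧ s.1 = 0) ∨ (u = b e ∧ s.1 + 1 = m) := Iff.rfl

@[simp]
theorem directedSubdivision_inr_inr (e f : E) (s t : Fin m) :
    (directedSubdivision a b m).Adj (.inr (e, s)) (.inr (f, t)) ↔
      e = f ∧ (s.1 + 1 = t.1 ∨ t.1 + 1 = s.1) := Iff.rfl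

end directedSubdivision

theorem pathVertex_eq_inl_iff {V : Type*} (H : SimpleGraph V) {m i : ℕ} (hi : i ≤ m + 1)
    (e : H.edgeSet) (u : V) :
    .inl u = pathVertex H m e i ↔
      (i = 0 ∧ u = (Quot.out e.1).1) ∨ (i = m + 1 ∧ u = (Quot.out e.1).2) := by
  rcases i with _ | i
  · simp [pathVertex]
  · by_cases h : i < m
    · simp [pathVertex, h]
      omega
    · simp [pathVertex, h]
      omega

theorem pathVertex_eq_inr_iff {V : Type*} (H : SimpleGraph V) {m i : ℕ}
    (e f : H.edgeSet) (s : Fin m) :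
    .inr (f, s) = pathVertex H m e i ↔ f = e ∧ i = s.1 + 1 := by
  rcases i with _ | i
  · simp [pathVertex]
  · by_cases h : i < m
    · simp [pathVertex, h, Fin.ext_iff, eq_comm]
    · simp [pathVertex, h]
      omega

/-- With `m = 0` the left side would join vertices of `H` directly, which the right side never does.
-/
theorem subdivision_eq_directedSubdivision {V : Type*} (H : SimpleGraph V) {m : ℕ} (hm : 1 ≤ m) :
    subdivision H m = directedSubdivision (fun e : H.edgeSet => (Quot.out e.1).1)
      (fun e => (Quot.out e.1).2) m := by
  ext x y
  rw [subdivision, SimpleGraph.fromRel_adj]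
  constructor
  · rintro ⟨hne, ⟨e, i, hi, h1, h2⟩ | ⟨e, i, hi, h1, h2⟩⟩
    all_goals
      rcases x with u | ⟨f, s⟩ <;> rcases y with w | ⟨g, t⟩ <;>
      simp only [pathVertex_eq_inl_iff H (show i ≤ m + 1 by omega),
        pathVertex_eq_inl_iff H (show i + 1 ≤ m + 1 by omega), pathVertex_eq_inr_iff] at h1 h2 <;>
      simp only [directedSubdivision_inl_inl, directedSubdivision_inl_inr,
        directedSubdivision_inr_inl, directedSubdivision_inr_inr] <;>
      grind
  · intro h
    refine ⟨h.ne, ?_⟩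
    rcases x with u | ⟨f, s⟩ <;> rcases y with w | ⟨g, t⟩
    · exact h.elim
    · rcases h with ⟨rfl, h⟩ | ⟨rfl, h⟩
      · refine .inl ⟨g, 0, by omega, ?_, ?_⟩
        · rw [pathVertex_eq_inl_iff H (by omega)]; simp
        · rw [pathVertex_eq_inr_iff]; simp [h]
      · refine .inr ⟨g, m, le_rfl, ?_, ?_⟩
        · rw [pathVertex_eq_inr_iff]; simp [h]
        · rw [pathVertex_eq_inl_iff H (by omega)]; simp
    · rcases h with ⟨rfl, h⟩ | ⟨rfl, h⟩
      · refine .inr ⟨f, 0, by omega, ?_, ?_⟩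
        · rw [pathVertex_eq_inl_iff H (by omega)]; simp
        · rw [pathVertex_eq_inr_iff]; simp [h]
      · refine .inl ⟨f, m, le_rfl, ?_, ?_⟩
        · rw [pathVertex_eq_inr_iff]; simp [h]
        · rw [pathVertex_eq_inl_iff H (by omega)]; simp
    · obtain ⟨rfl, h | h⟩ := h
      · refine .inl ⟨f, s.1 + 1, by omega, ?_, ?_⟩ <;> rw [pathVertex_eq_inr_iff] <;> simp [h]
      · refine .inr ⟨f, t.1 + 1, by omega, ?_, ?_⟩ <;> rw [pathVertex_eq_inr_iff] <;> simp [h]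

/-- Redirecting edges does not change the subdivision up to isomorphism. -/
theorem nonempty_iso_directedSubdivision {V E : Type*} (a b a' b' : E → V) (m : ℕ)
    (h : ∀ e, s(a e, b e) = s(a' e, b' e)) :
    Nonempty (directedSubdivision a b m ≃g directedSubdivision a' b' m) := by
  classical
  -- The inner path of an edge is reversed exactly when its direction changes.
  let r : E → Equiv.Perm (Fin m) := fun e => if a e = a' e then Equiv.refl _ else Fin.revPerm
  have hr1 : ∀ e, a e = a' e → r e = Equiv.refl _ := fun e he => if_pos he
  have hr2 : ∀ e, a e ≠ a' e → r e = Fin.revPerm := fun e he => if_neg he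
  refine ⟨⟨Equiv.sumCongr (Equiv.refl V) (Equiv.prodShear (Equiv.refl E) r), ?_⟩⟩
  have key : ∀ e, (a e = a' e ∧ b e = b' e ∧ ∀ s, (r e s).1 = s.1) ∨
      (a e = b' e ∧ b e = a' e ∧ ∀ s, (r e s).1 = m - (s.1 + 1)) := by
    intro e
    by_cases he : a e = a' e
    · refine .inl ⟨he, ?_, fun s => by rw [hr1 e he]; rfl⟩
      have := h e
      rw [he] at this
      exact Sym2.congr_right.mp this
    · refine .inr ?_
      have := h e
      rw [Sym2.eq_iff] at this
      rcases this with h' | h'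
      · exact absurd h'.1 he
      · exact ⟨h'.1, h'.2, fun s => by rw [hr2 e he]; simp [Fin.val_rev]⟩
  rintro (u | ⟨e, s⟩) (w | ⟨f, t⟩)
  · simp
  · have := key f
    have := t.2
    simp [Equiv.prodShear]
    grind
  · have := key e
    have := s.2
    simp [Equiv.prodShear]
    grind
  · have := key e
    have := s.2
    have := t.2
    simp [Equiv.prodShear]
    grind


/-! ### Walks between constant tuples -/

/-- Two tuples that differ in at least two coordinates. -/
def DifferTwice {ι K : Type*} (p q : ι → K) : Prop := ∃ i j, i ≠ j ∧ p i ≠ q i ∧ p j ≠ q j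

theorem DifferTwice.ne {ι K : Type*} {p q : ι → K} (h : DifferTwice p q) : p ≠ q := by
  obtain ⟨i, _, _, hi, _⟩ := h
  exact fun h => hi (congrFun h i)

theorem DifferTwice.not_existsUnique {ι K : Type*} {p q : ι → K} (h : DifferTwice p q) :
    ¬ ∃! i, p i ≠ q i := by
  obtain ⟨i, j, hij, hi, hj⟩ := h
  exact fun h => hij (h.unique hi hj)

theorem existsUnique_iff_eq_singleton {ι : Type*} {P : ι → Prop} {S : Finset ι}
    (h : ∀ i, P i ↔ i ∈ S) : (∃! i, P i) ↔ S.card = 1 := by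
  simp only [h, Finset.card_eq_one, ExistsUnique]
  constructor
  · rintro ⟨i, hi, hu⟩
    exact ⟨i, by ext j; simpa using ⟨hu j, fun h => h ▸ hi⟩⟩
  · rintro ⟨i, rfl⟩
    exact ⟨i, by simp⟩

section Trail

variable {n : ℕ} {V E : Type*}

/-- An order in which a walk of `n + 2` steps between two tuples of length `n` changes the
coordinates: the coordinates in `D` change in step `1`, the coordinate `l` in step `2`, and the
coordinate `i` receives its final value in step `T i`; the last step changes `j`. -/
structure IsSchedule (D : Finset (Fin n)) (l j : Fin n) (T : Fin n → ℕ) : Prop where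
  injective : Function.Injective T
  three_le : ∀ i, 3 ≤ T i
  le : ∀ i, T i ≤ n + 2
  surj : ∀ t, 3 ≤ t → t ≤ n + 2 → ∃ i, T i = t
  last : T j = n + 2
  late : n + 1 ≤ T l
  exists_late : ∃ i ∈ D, i ≠ l ∧ n + 1 ≤ T i

theorem exists_perm_apply_eq {α β : Type*} [Finite α] [Finite β] (h : Nat.card α = Nat.card β)
    {x y : α} {x' y' : β} (hxy : x = y ↔ x' = y') : ∃ e : α ≃ β, e x = x' ∧ e y = y' := by
  classical
  obtain ⟨e⟩ := (Finite.card_eq).1 h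
  by_cases hx : x = y
  · subst hx
    have := hxy.1 rfl
    exact ⟨e.trans (Equiv.swap (e x) x'), by simp, by simp [this]⟩
  · have hx' : x' ≠ y' := fun h => hx (hxy.2 h)
    let f := e.trans (Equiv.swap (e x) x')
    have hf : f x = x' := by simp [f]
    refine ⟨f.trans (Equiv.swap (f y) y'), ?_, by simp⟩
    rw [Equiv.trans_apply, hf, Equiv.swap_apply_of_ne_of_ne _ hx']
    rw [← hf]
    exact fun h => hx (f.injective h)

/-- It suffices that the two coordinates finished last are `j` and some `z`, with an element `i` of
`D` among them; `l` is then the other one. -/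
theorem exists_isSchedule (hn : 2 ≤ n) {D : Finset (Fin n)} (hD : D.Nonempty) (j : Fin n) :
    ∃ l T, IsSchedule D l j T := by
  obtain ⟨i, hi⟩ := hD
  obtain ⟨z, hz⟩ : ∃ z, z ≠ j ∧ (i ≠ j → z = i) := by
    by_cases h : i = j
    · have : Nontrivial (Fin n) := Fin.nontrivial_iff_two_le.2 hn
      obtain ⟨z, hz⟩ := exists_ne j
      exact ⟨z, hz, fun h' => absurd h h'⟩
    · exact ⟨i, h, fun _ => rfl⟩
  obtain ⟨e, hez, hej⟩ := exists_perm_apply_eq (α := Fin n) (β := Fin n) rfl (x := z) (y := j)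
    (x' := ⟨n - 2, by omega⟩) (y' := ⟨n - 1, by omega⟩)
    (by simp only [hz.1, false_iff, Fin.ext_iff]; omega)
  have hTz : (e z).1 + 3 = n + 1 := by rw [hez]; simp only []; omega
  have hTj : (e j).1 + 3 = n + 2 := by rw [hej]; simp only []; omega
  have aux : ∀ l, n + 1 ≤ (e l).1 + 3 → i ≠ l → n + 1 ≤ (e i).1 + 3 →
      IsSchedule D l j (fun i => (e i).1 + 3) := fun l hl hil hTi =>
    { injective := fun a b h => e.injective (Fin.ext (by simpa using h))
      three_le := fun i => by omega
      le := fun i => by have := (e i).2; omega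
      surj := fun t h3 ht => ⟨e.symm ⟨t - 3, by omega⟩, by simp; omega⟩
      last := hTj
      late := hl
      exists_late := ⟨i, hi, hil, hTi⟩ }
  by_cases h : i = j
  · exact ⟨z, _, aux z hTz.ge (fun h' => hz.1 (h' ▸ h)) (by rw [h]; omega)⟩
  · exact ⟨j, _, aux j (by omega) h (by rw [← hz.2 h]; omega)⟩

/-- The tuple reached after `s` steps on the walk from the constant tuple `u` to the constant tuple
`w` along the edge `e` that changes the coordinates according to a schedule. -/
def trail (u w : V) (e : E) (D : Finset (Fin n)) (l : Fin n) (T : Fin n → ℕ) (s : ℕ)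
    (i : Fin n) :
    V ⊕ (E × Bool) :=
  if T i ≤ s then .inl w
  else if i = l ∧ 2 ≤ s then .inr (e, true)
  else if i ∈ D ∧ 1 ≤ s then .inr (e, false)
  else .inl u

/-- `p` agrees with the constant tuple `x` except for the coordinates in `S`, where its values
belong to the edge `e`. -/
structure IsNear (p : Fin n → V ⊕ (E × Bool)) (e : E) (x : V) (S : Finset (Fin n)) : Prop where
  of_mem : ∀ i ∈ S, ∃ c, p i = .inr (e, c)
  of_notMem : ∀ i, i ∉ S → p i = .inl x

section IsNear

variable {p q : Fin n → V ⊕ (E × Bool)} {e f : E} {x y : V} {S S' : Finset (Fin n)}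

theorem IsNear.ne_iff_mem (hp : IsNear p e x S) (i : Fin n) : .inl x ≠ p i ↔ i ∈ S := by
  by_cases hi : i ∈ S
  · obtain ⟨c, hc⟩ := hp.of_mem i hi
    simp [hc, hi]
  · simp [hp.of_notMem i hi, hi]

theorem IsNear.differTwice_const (hn : 2 ≤ n) (hp : IsNear p e x S) (hxy : y ≠ x) :
    DifferTwice (fun _ => .inl y) p := by
  have : ∀ i, .inl y ≠ p i := fun i => by
    by_cases hi : i ∈ S
    · obtain ⟨c, hc⟩ := hp.of_mem i hi
      simp [hc]
    · simpa [hp.of_notMem i hi] using hxy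
  exact ⟨⟨0, by omega⟩, ⟨1, by omega⟩, by simp, this _, this _⟩

theorem IsNear.ne_iff_mem_union (hp : IsNear p e x S) (hq : IsNear q f x S') (hef : e ≠ f)
    (i : Fin n) : p i ≠ q i ↔ i ∈ S ∪ S' := by
  by_cases hi : i ∈ S <;> by_cases hi' : i ∈ S'
  · obtain ⟨c, hc⟩ := hp.of_mem i hi
    obtain ⟨d, hd⟩ := hq.of_mem i hi'
    simp [hc, hd, hi, hef]
  · obtain ⟨c, hc⟩ := hp.of_mem i hi
    simp [hc, hq.of_notMem i hi', hi]
  · obtain ⟨c, hc⟩ := hq.of_mem i hi'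
    simp [hc, hp.of_notMem i hi, hi']
  · simp [hp.of_notMem i hi, hq.of_notMem i hi', hi, hi']

theorem IsNear.differTwice (hn : 2 ≤ n) (hp : IsNear p e x S) (hq : IsNear q f y S')
    (hef : e ≠ f) (hxy : x ≠ y) : DifferTwice p q := by
  have : ∀ i, p i ≠ q i := fun i => by
    by_cases hi : i ∈ S <;> by_cases hi' : i ∈ S'
    · obtain ⟨c, hc⟩ := hp.of_mem i hi
      obtain ⟨d, hd⟩ := hq.of_mem i hi'
      simp [hc, hd, hef]
    · obtain ⟨c, hc⟩ := hp.of_mem i hi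
      simp [hc, hq.of_notMem i hi']
    · obtain ⟨c, hc⟩ := hq.of_mem i hi'
      simp [hc, hp.of_notMem i hi]
    · simp [hp.of_notMem i hi, hq.of_notMem i hi', hxy]
  exact ⟨⟨0, by omega⟩, ⟨1, by omega⟩, by simp, this _, this _⟩

end IsNear

section trail

variable {u w : V} {e : E} {D : Finset (Fin n)} {l j : Fin n} {T : Fin n → ℕ}

theorem IsSchedule.isNear_one (h : IsSchedule D l j T) : IsNear (trail u w e D l T 1) e u D where
  of_mem i hi := ⟨false, by have := h.three_le i; simp [trail, hi]; omega⟩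
  of_notMem i hi := by have := h.three_le i; simp [trail, hi]; omega

theorem IsSchedule.isNear_last (h : IsSchedule D l j T) (hn : 1 ≤ n) :
    IsNear (trail u w e D l T (n + 1)) e w {j} where
  of_mem i hi := by
    obtain rfl := Finset.mem_singleton.1 hi
    by_cases hil : i = l
    · exact ⟨true, by simp [trail, h.last, hil.symm]; omega⟩
    · obtain ⟨z, hz, hzl, hTz⟩ := h.exists_late
      have : i = z := h.injective (by
        have h1 := h.le z
        have h2 := h.le l
        have h3 := h.last
        have h4 := h.late
        have h5 : T z ≠ T l := fun h' => hzl (h.injective h')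
        have h6 : T i ≠ T l := fun h' => hil (h.injective h')
        omega)
      exact ⟨false, by simp [trail, h.last, hil, this ▸ hz]⟩
  of_notMem i hi := by
    have h1 : T i ≠ T j := fun h' => hi (Finset.mem_singleton.2 (h.injective h'))
    have h2 := h.le i
    have h3 := h.last
    simp [trail]
    omega

/-- Away from its ends the walk has two coordinates with values that belong to `e`. -/
theorem IsSchedule.exists_mid (h : IsSchedule D l j T) {s : ℕ} (h2 : 2 ≤ s) (hs : s ≤ n) :
    ∃ i k, i ≠ k ∧ (∃ c, trail u w e D l T s i = .inr (e, c)) ∧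
      ∃ c, trail u w e D l T s k = .inr (e, c) := by
  obtain ⟨i, hi, hil, hTi⟩ := h.exists_late
  have hTl := h.late
  have h1 : 1 ≤ s := by omega
  have h3 : ¬ T i ≤ s := by omega
  have h4 : ¬ T l ≤ s := by omega
  exact ⟨i, l, hil, ⟨false, by simp [trail, hi, hil, h1, h3]⟩, ⟨true, by simp [trail, h2, h4]⟩⟩

theorem IsSchedule.differTwice_mid (h : IsSchedule D l j T) {s : ℕ} (h2 : 2 ≤ s) (hs : s ≤ n)
    {q : Fin n → V ⊕ (E × Bool)} (hq : ∀ i c, q i ≠ .inr (e, c)) :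
    DifferTwice (trail u w e D l T s) q := by
  obtain ⟨i, k, hik, ⟨c, hc⟩, d, hd⟩ := h.exists_mid (u := u) (w := w) (e := e) h2 hs
  exact ⟨i, k, hik, hc ▸ (hq i c).symm, hd ▸ (hq k d).symm⟩

theorem trail_ne (huw : u ≠ w) {i : Fin n} {s t : ℕ} (hs : s < T i) (ht : T i ≤ t) :
    trail u w e D l T s i ≠ trail u w e D l T t i := by
  have : ¬ T i ≤ s := by omega
  simp only [trail, ht, this, if_true, if_false]
  split_ifs <;> simp [huw]

theorem trail_second_ne (huw : u ≠ w) {t : ℕ} (h2 : 2 ≤ t) (h3 : 3 ≤ T l) :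
    trail u w e D l T 1 l ≠ trail u w e D l T t l := by
  have : ¬ T l ≤ 1 := by omega
  simp only [trail, h2, this, if_false]
  split_ifs <;> simp_all

/-- This makes the walk induced: each coordinate finished in between differs at the two times, and
two such changes occur in different coordinates. -/
theorem IsSchedule.differTwice_trail (h : IsSchedule D l j T) (hn : 3 ≤ n) (huw : u ≠ w)
    {s t : ℕ} (h1 : 1 ≤ s) (hst : s + 2 ≤ t) (ht : t ≤ n + 2) :
    DifferTwice (trail u w e D l T s) (trail u w e D l T t) := by
  rcases h1.eq_or_lt with rfl | h1
  -- Steps `2` and `3` change different coordinates, since `T l ≥ n + 1 > 3`.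
  · obtain ⟨i, hi⟩ := h.surj 3 le_rfl (by omega)
    have hl := h.late
    refine ⟨l, i, ?_, trail_second_ne huw (by omega) (h.three_le l),
      trail_ne huw (by omega) (by omega)⟩
    rintro rfl
    omega
  · obtain ⟨i, hi⟩ := h.surj (s + 1) (by omega) (by omega)
    obtain ⟨k, hk⟩ := h.surj (s + 2) (by omega) (by omega)
    refine ⟨i, k, ?_, trail_ne huw (by omega) (by omega), trail_ne huw (by omega) (by omega)⟩
    rintro rfl
    omega

theorem IsSchedule.existsUnique_trail_succ (h : IsSchedule D l j T) (huw : u ≠ w)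
    {s : ℕ} (h1 : 1 ≤ s) (hs : s ≤ n + 1) :
    ∃! i, trail u w e D l T s i ≠ trail u w e D l T (s + 1) i := by
  rcases h1.eq_or_lt with rfl | h1
  · refine ⟨l, trail_second_ne huw le_rfl (h.three_le l), fun i hi => ?_⟩
    by_contra hil
    have := h.three_le i
    refine hi ?_
    have h1 : ¬ T i ≤ 1 := by omega
    have h2 : ¬ T i ≤ 1 + 1 := by omega
    simp [trail, hil, h1, h2]
  · obtain ⟨i, hi⟩ := h.surj (s + 1) (by omega) (by omega)
    refine ⟨i, trail_ne huw (by omega) (by omega), fun k hk => ?_⟩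
    by_contra hki
    have : T k ≠ T i := fun h' => hki (h.injective h')
    refine hk ?_
    have h1 : 2 ≤ s + 1 := by omega
    have h2 : 2 ≤ s := by omega
    have h3 : 1 ≤ s := by omega
    have h4 : T k ≤ s + 1 ↔ T k ≤ s := by omega
    simp [trail, h2, h3, h4]

end trail

end Trail


/-! ### Adjacencies in the drawing given by a layout -/

theorem card_union_singleton_eq_one {α : Type*} [DecidableEq α] {S : Finset α} {i : α}
    (hS : S.Nonempty) : (S ∪ {i}).card = 1 ↔ S = {i} := by
  constructor
  · intro h
    obtain ⟨j, hj⟩ := Finset.card_eq_one.1 h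
    have hi : i = j := by
      have : i ∈ S ∪ {i} := by simp
      simpa [hj] using this
    subst hi
    exact hS.subset_singleton_iff.1 (hj ▸ Finset.subset_union_left)
  · rintro rfl
    simp

/-- The choices that determine a drawing of a subdivision of `H` in a product of `n` cliques. Every
edge `e` is directed from `a e` to `b e` and drawn along a schedule; it leaves `a e` by changing the
coordinates in `D e`, and enters `b e` by changing the coordinate `dir (b e) e`. Distinct
edges at a vertex use distinct coordinates, apart from the edge `e₁` at `v`. -/
structure Layout {V : Type*} (H : SimpleGraph V) (n : ℕ) (v : V) (e₁ : H.edgeSet) where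
  a : H.edgeSet → V
  b : H.edgeSet → V
  mk_eq : ∀ e, s(a e, b e) = e.1
  a_eq : ∀ e : H.edgeSet, v ∈ e.1 → a e = v
  mem : v ∈ e₁.1
  dir : V → H.edgeSet → Fin n
  dir_inj : ∀ x (e f : H.edgeSet), x ∈ e.1 → x ∈ f.1 → (x = v → e ≠ e₁ ∧ f ≠ e₁) →
    dir x e = dir x f → e = f
  D : H.edgeSet → Finset (Fin n)
  D_eq : ∀ e, e ≠ e₁ → D e = {dir (a e) e}
  l : H.edgeSet → Fin n
  T : H.edgeSet → Fin n → ℕ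
  isSchedule : ∀ e, IsSchedule (D e) (l e) (dir (b e) e) (T e)

namespace Layout

variable {V : Type*} {H : SimpleGraph V} {n : ℕ} {v : V} {e₁ : H.edgeSet} (L : Layout H n v e₁)

/-- The tuple at which a vertex of the subdivision is drawn. -/
def point : V ⊕ (H.edgeSet × Fin (n + 1)) → Fin n → V ⊕ (H.edgeSet × Bool)
  | .inl u => fun _ => .inl u
  | .inr (e, s) => trail (L.a e) (L.b e) e (L.D e) (L.l e) (L.T e) (s.1 + 1)

theorem a_ne_b (e : H.edgeSet) : L.a e ≠ L.b e := by
  have h := e.2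
  rw [← L.mk_eq e] at h
  exact H.ne_of_adj h

theorem a_mem (e : H.edgeSet) : L.a e ∈ e.1 := by rw [← L.mk_eq e]; simp

theorem b_mem (e : H.edgeSet) : L.b e ∈ e.1 := by rw [← L.mk_eq e]; simp

theorem b_ne (e : H.edgeSet) : L.b e ≠ v := fun h =>
  L.a_ne_b e ((L.a_eq e (h ▸ L.b_mem e)).trans h.symm)

theorem D_nonempty (e : H.edgeSet) : (L.D e).Nonempty :=
  let ⟨i, hi, _⟩ := (L.isSchedule e).exists_late
  ⟨i, hi⟩

theorem isNear_zero (e : H.edgeSet) : IsNear (L.point (.inr (e, 0))) e (L.a e) (L.D e) :=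
  (L.isSchedule e).isNear_one

theorem isNear_last (hn : 1 ≤ n) (e : H.edgeSet) {s : Fin (n + 1)} (hs : s.1 = n) :
    IsNear (L.point (.inr (e, s))) e (L.b e) {L.dir (L.b e) e} := by
  have := (L.isSchedule e).isNear_last (u := L.a e) (w := L.b e) (e := e) hn
  simpa only [point, hs] using this

/-- An inner vertex either carries two private letters or is the first or last of its walk, hence
near an end `x`. As edges at `v` are directed away from `v`, only first vertices are near `v`. -/
theorem end_cases (hn : 1 ≤ n) (e : H.edgeSet) (s : Fin (n + 1)) :
    (1 ≤ s.1 ∧ s.1 + 1 ≤ n) ∨ ∃ x S, x ∈ e.1 ∧ IsNear (L.point (.inr (e, s))) e x S ∧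
      (x = v → L.a e = v ∧ s = 0) ∧ (s = 0 → x = L.a e) ∧
      (((x = v → e ≠ e₁) ∧ S = {L.dir x e}) ∨ (e = e₁ ∧ s = 0 ∧ x = v ∧ S = L.D e₁)) := by
  by_cases h0 : s = 0
  · subst h0
    refine .inr ⟨_, _, L.a_mem e, L.isNear_zero e, fun h => ⟨h, rfl⟩, fun _ => rfl, ?_⟩
    by_cases he : e = e₁
    · subst he
      exact .inr ⟨rfl, rfl, L.a_eq _ L.mem, rfl⟩
    · exact .inl ⟨fun _ => he, L.D_eq e he⟩
  · by_cases hs : s.1 = n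
    · refine .inr ⟨L.b e, {L.dir (L.b e) e}, L.b_mem e, L.isNear_last hn e hs,
        fun h => absurd h (L.b_ne e), fun h => absurd h h0,
        .inl ⟨fun h => absurd h (L.b_ne e), rfl⟩⟩
    · have := Fin.val_ne_zero_iff.2 h0
      have := s.2
      exact .inl ⟨by omega, by omega⟩

theorem exists_fresh (hn : 1 ≤ n) (e : H.edgeSet) (s : Fin (n + 1)) :
    ∃ i c, L.point (.inr (e, s)) i = .inr (e, c) := by
  rcases L.end_cases hn e s with ⟨h1, h2⟩ | ⟨x, S, -, hS, -, -, h⟩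
  · obtain ⟨i, -, -, ⟨c, hc⟩, -⟩ := (L.isSchedule e).exists_mid (u := L.a e) (w := L.b e)
      (e := e) (s := s.1 + 1) (by omega) h2
    exact ⟨i, c, hc⟩
  · have : S.Nonempty := by
      rcases h with ⟨-, rfl⟩ | ⟨-, -, -, rfl⟩
      · simp
      · exact L.D_nonempty e₁
    obtain ⟨i, hi⟩ := this
    exact ⟨i, hS.of_mem i hi⟩

/-- Private letters identify the edge; this separates the walks. -/
theorem eq_of_point_eq_inr {x : V ⊕ (H.edgeSet × Fin (n + 1))} {i : Fin n} {e : H.edgeSet}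
    {c : Bool} (h : L.point x i = .inr (e, c)) : ∃ s, x = .inr (e, s) := by
  rcases x with u | ⟨f, s⟩
  · simp [point] at h
  · refine ⟨s, ?_⟩
    simp only [point, trail] at h
    split_ifs at h <;> simp_all

theorem existsUnique_point_same (hn : 3 ≤ n) (e : H.edgeSet) {s t : Fin (n + 1)}
    (hst : s < t) : L.point (.inr (e, s)) ≠ L.point (.inr (e, t)) ∧
      ((∃! i, L.point (.inr (e, s)) i ≠ L.point (.inr (e, t)) i) ↔ s.1 + 1 = t.1) := by
  have ht := t.2
  have hst' : s.1 < t.1 := hst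
  by_cases h : s.1 + 1 = t.1
  · have := (L.isSchedule e).existsUnique_trail_succ (L.a_ne_b e) (e := e) (s := s.1 + 1)
      (by omega) (by omega)
    simp only [point, ← h]
    refine ⟨fun h' => ?_, iff_of_true this trivial⟩
    obtain ⟨i, hi, -⟩ := this
    exact hi (congrFun h' i)
  · have := (L.isSchedule e).differTwice_trail (e := e) hn (L.a_ne_b e) (s := s.1 + 1)
      (t := t.1 + 1) (by omega) (by omega) (by omega)
    exact ⟨this.ne, iff_of_false this.not_existsUnique h⟩

theorem point_injective (hn : 3 ≤ n) : Function.Injective L.point := by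
  rintro (u | ⟨e, s⟩) y h
  · rcases y with w | ⟨f, t⟩
    · simpa [point] using congrFun h ⟨0, by omega⟩
    · obtain ⟨i, c, hc⟩ := L.exists_fresh (by omega) f t
      rw [← h] at hc
      simpa using L.eq_of_point_eq_inr hc
  · obtain ⟨i, c, hc⟩ := L.exists_fresh (by omega) e s
    rw [h] at hc
    obtain ⟨t, rfl⟩ := L.eq_of_point_eq_inr hc
    rcases lt_trichotomy s t with hst | rfl | hst
    · exact absurd h (L.existsUnique_point_same hn e hst).1
    · rfl
    · exact absurd h.symm (L.existsUnique_point_same hn e hst).1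

theorem existsUnique_point_inl_inr (hn : 3 ≤ n) (u : V) (e : H.edgeSet) (s : Fin (n + 1)) :
    (∃! i, L.point (.inl u) i ≠ L.point (.inr (e, s)) i) ↔
      (directedSubdivision L.a L.b (n + 1)).Adj (.inl u) (.inr (e, s)) ∧
        (u = v → e = e₁ → s = 0 → (L.D e₁).card = 1) := by
  rw [directedSubdivision_inl_inr]
  by_cases h0 : s = 0
  · subst h0
    have hS := L.isNear_zero e
    by_cases hu : u = L.a e
    · subst hu
      refine (existsUnique_iff_eq_singleton (fun i => hS.ne_iff_mem i)).trans ?_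
      by_cases he : e = e₁
      · subst he
        simp [L.a_eq _ L.mem]
      · simp [L.D_eq e he, he]
    · refine iff_of_false (hS.differTwice_const (by omega) hu).not_existsUnique ?_
      simp [hu]
      omega
  · have h0' := Fin.val_ne_zero_iff.2 h0
    by_cases hs : s.1 = n
    · have hS := L.isNear_last (by omega) e hs
      by_cases hu : u = L.b e
      · subst hu
        refine iff_of_true ((existsUnique_iff_eq_singleton (fun i => hS.ne_iff_mem i)).2 (by simp))
          ?_
        simp [hs, h0]
      · refine iff_of_false (hS.differTwice_const (by omega) hu).not_existsUnique ?_
        simp [hu, h0]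
    · have := s.2
      obtain ⟨i, k, hik, ⟨c, hc⟩, d, hd⟩ := (L.isSchedule e).exists_mid (u := L.a e) (w := L.b e)
        (e := e) (s := s.1 + 1) (by omega) (by omega)
      have h : DifferTwice (L.point (.inl u)) (L.point (.inr (e, s))) :=
        ⟨i, k, hik, by simp [point, hc], by simp [point, hd]⟩
      refine iff_of_false h.not_existsUnique ?_
      simp [h0, hs]

/-- The only pairs on different edges that can be joined in the drawing are the first new vertex
of `e₁` and that of another edge at `v`. -/
theorem existsUnique_point_inr_inr (hn : 3 ≤ n) {e f : H.edgeSet} (hef : e ≠ f)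
    (s t : Fin (n + 1)) :
    (∃! i, L.point (.inr (e, s)) i ≠ L.point (.inr (f, t)) i) ↔
      s = 0 ∧ t = 0 ∧ ((e = e₁ ∧ L.a f = v ∧ L.D e₁ = {L.dir v f}) ∨
        (f = e₁ ∧ L.a e = v ∧ L.D e₁ = {L.dir v e})) := by
  rcases L.end_cases (by omega) e s with ⟨h1, h2⟩ | ⟨x, S, hx, hS, hxv, hx0, hxS⟩
  · have := (L.isSchedule e).differTwice_mid (u := L.a e) (w := L.b e)
      (e := e) (s := s.1 + 1) (q := L.point (.inr (f, t))) (by omega) h2 (fun i c h => by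
        obtain ⟨_, h⟩ := L.eq_of_point_eq_inr h
        simp only [Sum.inr.injEq, Prod.mk.injEq] at h
        exact hef h.1.symm)
    exact iff_of_false this.not_existsUnique (by rintro ⟨rfl, -⟩; simp at h1)
  rcases L.end_cases (by omega) f t with ⟨h1, h2⟩ | ⟨y, S', hy, hS', hyv, hy0, hyS⟩
  · have := (L.isSchedule f).differTwice_mid (u := L.a f) (w := L.b f)
      (e := f) (s := t.1 + 1) (q := L.point (.inr (e, s))) (by omega) h2 (fun i c h => by
        obtain ⟨_, h⟩ := L.eq_of_point_eq_inr h
        simp only [Sum.inr.injEq, Prod.mk.injEq] at h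
        exact hef h.1)
    refine iff_of_false (fun h => this.not_existsUnique ?_) (by rintro ⟨-, rfl, -⟩; simp at h1)
    simp only [ne_comm (a := L.point (.inr (e, s)) _)] at h
    exact h
  have ha := L.a_eq _ L.mem
  by_cases hxy : x = y
  · subst hxy
    rw [existsUnique_iff_eq_singleton (fun i => hS.ne_iff_mem_union hS' hef i)]
    rcases hxS with ⟨hxe, rfl⟩ | ⟨rfl, rfl, rfl, rfl⟩
    · rcases hyS with ⟨hxf, rfl⟩ | ⟨rfl, rfl, rfl, rfl⟩
      · refine iff_of_false ?_ ?_
        · rw [card_union_singleton_eq_one (by simp), Finset.singleton_inj]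
          exact fun h => hef (L.dir_inj x e f hx hy (fun h => ⟨hxe h, hxf h⟩) h)
        · rintro ⟨rfl, rfl, ⟨rfl, -⟩ | ⟨rfl, -⟩⟩
          · exact hxe ((hx0 rfl).trans ha) rfl
          · exact hxf ((hy0 rfl).trans ha) rfl
      · rw [Finset.union_comm, card_union_singleton_eq_one (L.D_nonempty _)]
        have := hxv rfl
        simp [this, hef]
    · rcases hyS with ⟨hxf, rfl⟩ | ⟨rfl, -⟩
      · rw [card_union_singleton_eq_one (L.D_nonempty _)]
        have := hyv rfl
        simp [this, hef.symm]
      · exact absurd rfl hef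
  · refine iff_of_false (hS.differTwice (by omega) hS' hef hxy).not_existsUnique ?_
    rintro ⟨rfl, rfl, ⟨rfl, h, -⟩ | ⟨rfl, h, -⟩⟩
    · exact hxy ((hx0 rfl).trans (ha.trans (h.symm.trans (hy0 rfl).symm)))
    · exact hxy ((hx0 rfl).trans (h.trans (ha.symm.trans (hy0 rfl).symm)))

/-- The complete list of defects of the drawing: the first edge of `e₁` is missing unless `D` is a
singleton, and a surplus edge appears only when `D` is the direction of another edge at `v`. -/
theorem existsUnique_point_iff (hn : 3 ≤ n) (x y : V ⊕ (H.edgeSet × Fin (n + 1))) :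
    (∃! i, L.point x i ≠ L.point y i) ↔
      ((directedSubdivision L.a L.b (n + 1)).Adj x y ∧
        (s(x, y) = s(.inl v, .inr (e₁, 0)) → (L.D e₁).card = 1)) ∨
      ∃ g, g ≠ e₁ ∧ L.a g = v ∧ s(x, y) = s(.inr (e₁, 0), .inr (g, 0)) ∧
        L.D e₁ = {L.dir v g} := by
  rcases x with u | ⟨e, s⟩ <;> rcases y with w | ⟨f, t⟩
  · simp only [directedSubdivision_inl_inl]
    refine iff_of_false ?_ (by simp)
    simp only [point]
    rintro ⟨i, h, hu⟩
    have h1 := hu ⟨0, by omega⟩ h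
    have h2 := hu ⟨1, by omega⟩ h
    simpa using h1.trans h2.symm
  · rw [L.existsUnique_point_inl_inr hn]
    simp
  · simp only [ne_comm (a := L.point (.inr (e, s)) _)]
    rw [L.existsUnique_point_inl_inr hn, SimpleGraph.adj_comm]
    simp
    grind
  · by_cases hef : e = f
    · subst hef
      have hne : ∀ g, g ≠ e₁ → ¬ (s((.inr (e, s) : V ⊕ (H.edgeSet × Fin (n + 1))), .inr (e, t)) =
          s(.inr (e₁, 0), .inr (g, 0))) := by
        intro g hg h
        simp at h
        grind
      rw [directedSubdivision_inr_inr, or_iff_left (by rintro ⟨g, hg, -, h, -⟩; exact hne g hg h)]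
      rcases lt_trichotomy s t with hst | rfl | hst
      · rw [(L.existsUnique_point_same hn e hst).2]
        have : s.1 < t.1 := hst
        simp
        omega
      · simp [ExistsUnique]
      · simp only [ne_comm (a := L.point (.inr (e, s)) _)]
        rw [(L.existsUnique_point_same hn e hst).2]
        have : t.1 < s.1 := hst
        simp
        omega
    · rw [L.existsUnique_point_inr_inr hn hef]
      simp [hef]
      grind

end Layout


/-! ### Existence of layouts, and the degree obstruction -/

section Existence

variable {V : Type*} [Fintype V] [DecidableEq V] (H : SimpleGraph V) [DecidableRel H.Adj]

theorem card_filter_mem_edgeSet (x : V) :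
    (Finset.univ.filter fun e : H.edgeSet => x ∈ e.1).card = H.degree x := by
  rw [← H.card_incidenceFinset_eq_degree x,
    ← Finset.card_map (Function.Embedding.subtype (· ∈ H.edgeSet))]
  congr 1
  ext e
  simp [SimpleGraph.incidenceSet, and_comm]

theorem exists_injOn_fin {α : Type*} {n : ℕ} (hn : 1 ≤ n) (S : Finset α) (hS : S.card ≤ n) :
    ∃ f : α → Fin n, Set.InjOn f S := by
  classical
  have : Nonempty (S ↪ Fin n) := Function.Embedding.nonempty_of_card_le (by simpa using hS)
  obtain ⟨f⟩ := this
  refine ⟨fun x => if h : x ∈ S then f ⟨x, h⟩ else ⟨0, hn⟩, fun x hx y hy h => ?_⟩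
  have hx : x ∈ S := hx
  have hy : y ∈ S := hy
  simpa [hx, hy] using h

theorem Layout.exists {n : ℕ} (hn : 2 ≤ n) {v : V} (hv : H.degree v = n + 1)
    (hu : ∀ u, u ≠ v → H.degree u ≤ n) {e₁ : H.edgeSet} (he₁ : v ∈ e₁.1) {D₀ : Finset (Fin n)}
    (hD₀ : D₀.Nonempty) : ∃ L : Layout H n v e₁, L.D e₁ = D₀ := by
  have h1 : ∀ e : H.edgeSet, ∃ p : V × V, s(p.1, p.2) = e.1 ∧ (v ∈ e.1 → p.1 = v) := by
    intro e
    by_cases h : v ∈ e.1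
    · obtain ⟨w, hw⟩ := Sym2.mem_iff_exists.1 h
      exact ⟨(v, w), hw.symm, fun _ => rfl⟩
    · obtain ⟨p, hp⟩ := Sym2.mk_surjective e.1
      exact ⟨p, hp, fun h' => absurd h' h⟩
  choose p hp hpv using h1
  have h2 : ∀ x, ∃ f : H.edgeSet → Fin n, ∀ e f' : H.edgeSet, x ∈ e.1 → x ∈ f'.1 →
      (x = v → e ≠ e₁ ∧ f' ≠ e₁) → f e = f f' → e = f' := by
    intro x
    by_cases hx : x = v
    · subst hx
      obtain ⟨f, hf⟩ := exists_injOn_fin (n := n) (by omega)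
        ((Finset.univ.filter fun e : H.edgeSet => x ∈ e.1).erase e₁) (by
          rw [Finset.card_erase_of_mem (by simpa using he₁), card_filter_mem_edgeSet]
          omega)
      exact ⟨f, fun e f' he hf' hne h => hf (by simp [he, (hne rfl).1])
        (by simp [hf', (hne rfl).2]) h⟩
    · obtain ⟨f, hf⟩ := exists_injOn_fin (n := n) (by omega)
        (Finset.univ.filter fun e : H.edgeSet => x ∈ e.1) (by
          rw [card_filter_mem_edgeSet]
          exact hu x hx)
      exact ⟨f, fun e f' he hf' _ h => hf (by simp [he]) (by simp [hf']) h⟩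
  choose dir hdir using h2
  let D : H.edgeSet → Finset (Fin n) := fun e => if e = e₁ then D₀ else {dir (p e).1 e}
  have hD : ∀ e, (D e).Nonempty := by
    intro e
    by_cases he : e = e₁ <;> simp [D, he, hD₀]
  choose l T hT using fun e => exists_isSchedule hn (hD e) (dir (p e).2 e)
  exact ⟨⟨fun e => (p e).1, fun e => (p e).2, hp, hpv, he₁, dir, hdir, D,
    fun e he => by simp [D, he], l, T, hT⟩, by simp [D]⟩

/-- The `n` edges at `v` other than `e₁` have distinct directions, so they exhaust the `n`
coordinates. -/
theorem Layout.exists_dir_eq {n : ℕ} {v : V} (hv : H.degree v = n + 1)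
    {e₁ : H.edgeSet} (L : Layout H n v e₁) (i : Fin n) :
    ∃ g, g ≠ e₁ ∧ v ∈ g.1 ∧ L.dir v g = i := by
  obtain ⟨g, hg, hgi⟩ := Finset.surj_on_of_inj_on_of_card_le
    (s := (Finset.univ.filter fun e : H.edgeSet => v ∈ e.1).erase e₁) (t := Finset.univ)
    (fun e _ => L.dir v e) (fun _ _ => Finset.mem_univ _)
    (fun e f he hf h => by
      simp only [Finset.mem_erase, Finset.mem_filter, Finset.mem_univ, true_and] at he hf
      exact L.dir_inj v e f he.2 hf.2 (fun _ => ⟨he.1, hf.1⟩) h)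
    (by
      rw [Finset.card_erase_of_mem (by simpa using L.mem), card_filter_mem_edgeSet, hv]
      simp) i (Finset.mem_univ _)
  simp only [Finset.mem_erase, Finset.mem_filter, Finset.mem_univ, true_and] at hg
  exact ⟨g, hg.1, hg.2, hgi.symm⟩

/-- A vertex of degree greater than `n` prevents induced copies of the subdivision in a product
of `n` cliques. -/
theorem not_isIndContained_cliqueProduct {n m : ℕ} (k : ℕ) (hm : 1 ≤ m) {v : V}
    (hv : n < H.degree v) : ¬ (subdivision H m).IsIndContained (cliqueProduct n k) := by
  rintro ⟨f⟩
  rw [subdivision_eq_directedSubdivision H hm] at f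
  have h1 : ∀ e : H.edgeSet, ∃ q : Fin m, v ∈ e.1 → (directedSubdivision
      (fun e : H.edgeSet => (Quot.out e.1).1) (fun e => (Quot.out e.1).2) m).Adj
      (.inl v) (.inr (e, q)) := by
    intro e
    have he : s((Quot.out e.1).1, (Quot.out e.1).2) = e.1 := Quot.out_eq e.1
    by_cases h : v = (Quot.out e.1).1
    · exact ⟨⟨0, hm⟩, fun _ => .inl ⟨h, rfl⟩⟩
    · refine ⟨⟨m - 1, by omega⟩, fun h' => .inr ⟨?_, by simp only []; omega⟩⟩
      rw [← he, Sym2.mem_iff] at h'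
      exact h'.resolve_left h
  choose q hq using h1
  have h2 : ∀ e : H.edgeSet, ∃ i, v ∈ e.1 →
      ∀ j, f (.inl v) j ≠ f (.inr (e, q e)) j ↔ j = i := by
    intro e
    by_cases h : v ∈ e.1
    · obtain ⟨i, hi, hu⟩ := f.map_rel_iff.2 (hq e h)
      exact ⟨i, fun _ j => ⟨hu j, fun h => h ▸ hi⟩⟩
    · have : 0 < n := by
        obtain ⟨w, hw⟩ := (H.degree_pos_iff_exists_adj v).1 (by omega)
        obtain ⟨i, -⟩ := f.map_rel_iff.2 (hq ⟨s(v, w), hw⟩ (by simp))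
        exact i.pos
      exact ⟨⟨0, this⟩, fun h' => absurd h' h⟩
  choose d hd using h2
  -- By pigeonhole two neighbours of `v` are reached by changing the same coordinate, so their
  -- images are adjacent, although new vertices on different edges are not.
  obtain ⟨e, he, g, hg, heg, hdir⟩ := Finset.exists_ne_map_eq_of_card_lt_of_maps_to
    (s := Finset.univ.filter fun e : H.edgeSet => v ∈ e.1) (t := Finset.univ) (f := d)
    (by rw [card_filter_mem_edgeSet]; simpa using hv) (fun _ _ => Finset.mem_univ _)
  simp only [Finset.mem_filter, Finset.mem_univ, true_and] at he hg
  have hsame : ∀ j, j ≠ d e → f (.inr (e, q e)) j = f (.inr (g, q g)) j := by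
    intro j hj
    have h1 := not_iff_not.2 (hd e he j)
    have h2 := not_iff_not.2 (hd g hg j)
    rw [← hdir] at h2
    simp only [not_not] at h1 h2
    exact (h1.2 hj).symm.trans (h2.2 hj)
  have hne : f (.inr (e, q e)) ≠ f (.inr (g, q g)) := fun h => heg (by
    have := f.injective h
    simp only [Sum.inr.injEq, Prod.mk.injEq] at this
    exact this.1)
  have hadj : (cliqueProduct n k).Adj (f (.inr (e, q e))) (f (.inr (g, q g))) := by
    refine ⟨d e, fun h => hne (funext fun j => ?_), fun j hj => by_contra fun h => hj (hsame j h)⟩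
    by_cases hj : j = d e
    · exact hj ▸ h
    · exact hsame j hj
  exact heg (f.map_rel_iff.1 hadj).1

end Existence

/-! ### From a drawing with one defect to an induced copy at a given pair -/

theorem isIndContained_deleteEdges {U W : Type*} {G : SimpleGraph W} {S : SimpleGraph U}
    {F : U → W} (hF : Function.Injective F) {α β : U} (hαβ : ¬ S.Adj α β)
    (h : ∀ x y, G.Adj (F x) (F y) ↔ S.Adj x y ∨ s(x, y) = s(α, β)) :
    S.IsIndContained (G.deleteEdges {s(F α, F β)}) := by
  refine ⟨⟨⟨F, hF⟩, ?_⟩⟩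
  intro x y
  have h1 : s(F x, F y) = s(F α, F β) ↔ s(x, y) = s(α, β) := (Sym2.map.injective hF).eq_iff
    (a := s(x, y)) (b := s(α, β))
  have h2 : s(x, y) = s(α, β) → ¬ S.Adj x y := by
    intro h'
    rwa [← SimpleGraph.mem_edgeSet, h', SimpleGraph.mem_edgeSet]
  simp only [Function.Embedding.coeFn_mk, SimpleGraph.deleteEdges_adj, h, Set.mem_singleton_iff, h1]
  tauto

theorem isIndContained_sup_edge {U W : Type*} {G : SimpleGraph W} {S : SimpleGraph U}
    {F : U → W} (hF : Function.Injective F) {α β : U} (hαβ : S.Adj α β)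
    (h : ∀ x y, G.Adj (F x) (F y) ↔ S.Adj x y ∧ s(x, y) ≠ s(α, β)) :
    S.IsIndContained (G ⊔ SimpleGraph.edge (F α) (F β)) := by
  refine ⟨⟨⟨F, hF⟩, ?_⟩⟩
  intro x y
  have h1 : s(F x, F y) = s(F α, F β) ↔ s(x, y) = s(α, β) := (Sym2.map.injective hF).eq_iff
    (a := s(x, y)) (b := s(α, β))
  have h2 : s(x, y) = s(α, β) → S.Adj x y := by
    intro h'
    rwa [← SimpleGraph.mem_edgeSet, h', SimpleGraph.mem_edgeSet]
  have h3 : (SimpleGraph.edge (F α) (F β)).Adj (F x) (F y) ↔ s(x, y) = s(α, β) := by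
    rw [← h1, SimpleGraph.edge_adj, Sym2.eq_iff]
    refine and_iff_left_of_imp fun h' hxy => ?_
    have : F α = F β := by
      rcases h' with ⟨h3, h4⟩ | ⟨h3, h4⟩
      · rw [← h3, ← h4, hxy]
      · rw [← h3, ← h4, hxy]
    exact hαβ.ne (hF this)
  simp only [Function.Embedding.coeFn_mk, SimpleGraph.sup_adj, h, h3]
  tauto

/-- A map into tuples over `K` can be relabelled coordinatewise so that two given tuples are hit,
provided that the two pairs of tuples differ in the same coordinates. -/
theorem exists_relabel {U K : Type*} [Finite K] {n k : ℕ} (hk : Nat.card K = k)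
    {F : U → Fin n → K} (hF : Function.Injective F) {α β : U} {x y : Fin n → Fin k}
    (h : ∀ i, F α i = F β i ↔ x i = y i) :
    ∃ F' : U → Fin n → Fin k, Function.Injective F' ∧ F' α = x ∧ F' β = y ∧
      ∀ a b, (cliqueProduct n k).Adj (F' a) (F' b) ↔ ∃! i, F a i ≠ F b i := by
  choose φ hφ using fun i => exists_perm_apply_eq (by rw [hk, Nat.card_fin]) (h i)
  refine ⟨fun a i => φ i (F a i), fun a b hab => hF (funext fun i => (φ i).injective
    (congrFun hab i)), funext fun i => (hφ i).1, funext fun i => (hφ i).2, fun a b => ?_⟩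
  simp [cliqueProduct]

theorem subdivision_isIndContained_of_directed {V W : Type*} {H : SimpleGraph V} {n : ℕ} {v : V}
    {e₁ : H.edgeSet} (L : Layout H n v e₁) {G : SimpleGraph W}
    (h : (directedSubdivision L.a L.b (n + 1)).IsIndContained G) :
    (subdivision H (n + 1)).IsIndContained G := by
  rw [subdivision_eq_directedSubdivision H (by omega)]
  obtain ⟨f⟩ := nonempty_iso_directedSubdivision _ _ L.a L.b (n + 1)
    (fun e : H.edgeSet => (Quot.out_eq e.1).trans (L.mk_eq e).symm)
  obtain ⟨g⟩ := h
  exact ⟨g.comp f.toEmbedding⟩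

end InducedSaturation

theorem corollary3 {V : Type*} [Fintype V] [DecidableEq V] (H : SimpleGraph V)
    [DecidableRel H.Adj] (n : ℕ) (hn : 4 ≤ n) (v : V)
    (hmax : H.maxDegree = n + 1)
    (hunique : ∀ u, H.degree u = H.maxDegree ↔ u = v)
    (hdel : (H.induce {u | u ≠ v}).maxDegree ≤ n - 1) :
    ∃ k : ℕ, 2 ≤ k ∧
      InducedSaturation.IsInducedSaturated (InducedSaturation.cliqueProduct n k)
        (InducedSaturation.subdivision H (n + 1)) := by
  open InducedSaturation in
  have hv : H.degree v = n + 1 := hmax ▸ (hunique v).2 rfl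
  have hu : ∀ u, u ≠ v → H.degree u ≤ n := by
    intro u hu
    have h1 := H.degree_le_maxDegree u
    have h2 : H.degree u ≠ H.maxDegree := fun h => hu ((hunique u).1 h)
    omega
  obtain ⟨w, hw⟩ := (H.degree_pos_iff_exists_adj v).1 (by omega)
  let e₁ : H.edgeSet := ⟨s(v, w), hw⟩
  have he₁ : v ∈ e₁.1 := by simp [e₁]
  refine ⟨Nat.card (V ⊕ (H.edgeSet × Bool)), ?_, not_isIndContained_cliqueProduct H _ (by omega)
    (v := v) (by omega), ?_, ?_⟩
  · have : Nontrivial (V ⊕ (H.edgeSet × Bool)) := ⟨.inl v, .inl w, by simpa using hw.ne⟩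
    exact Finite.one_lt_card
  · rintro x y ⟨i, hi, hiu⟩
    -- With `D = {i}` the surplus edge has both ends near `v` and varies only coordinate `i`, like
    -- the edge to be deleted.
    obtain ⟨L, hL⟩ := Layout.exists H (by omega) hv hu he₁ (Finset.singleton_nonempty i)
    obtain ⟨g, hg, hvg, hgi⟩ := L.exists_dir_eq H hv i
    have hag := L.a_eq g hvg
    have hS := L.isNear_zero e₁
    rw [L.a_eq e₁ he₁] at hS
    have hS' := L.isNear_zero g
    rw [hag] at hS'
    obtain ⟨F, hF, rfl, rfl, hadj⟩ := exists_relabel rfl (L.point_injective (by omega))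
      (α := .inr (e₁, 0)) (β := .inr (g, 0)) (x := x) (y := y) (fun j => by
        rw [← not_iff_not]
        refine (hS.ne_iff_mem_union hS' hg.symm j).trans ?_
        rw [hL, L.D_eq g hg, hag, hgi]
        simp only [Finset.union_idempotent, Finset.mem_singleton]
        exact ⟨fun h => h ▸ hi, hiu j⟩)
    refine subdivision_isIndContained_of_directed L
      (isIndContained_deleteEdges hF (by simp [hg.symm]) fun p q => ?_)
    rw [hadj, L.existsUnique_point_iff (by omega), hL]
    refine or_congr (by simp) ⟨?_, fun h => ⟨g, hg, hag, h, by rw [hgi]⟩⟩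
    -- Only one edge at `v` besides `e₁` has direction `i`, so the surplus edge is unique.
    rintro ⟨g', hg', hag', h, hgi'⟩
    rw [Finset.singleton_inj] at hgi'
    have : g = g' := L.dir_inj v g g' hvg (hag' ▸ L.a_mem g') (fun _ => ⟨hg, hg'⟩)
      (hgi.trans hgi')
    rwa [this]
  · rintro x y ⟨hne, hnadj⟩
    have hne' : (Finset.univ.filter fun i => x i ≠ y i).Nonempty := by
      obtain ⟨i, hi⟩ := Function.ne_iff.1 hne
      exact ⟨i, by simpa using hi⟩
    -- Here `D` is the set of coordinates in which `x` and `y` differ. It has at least two elements,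
    -- so the first edge of `e₁` is missing and no surplus edge arises.
    obtain ⟨L, hL⟩ := Layout.exists H (by omega) hv hu he₁ hne'
    have hcard : (L.D e₁).card ≠ 1 := fun h => hnadj
      ((existsUnique_iff_eq_singleton (fun i => by simp [hL])).2 h)
    have hS := L.isNear_zero e₁
    rw [L.a_eq e₁ he₁] at hS
    obtain ⟨F, hF, rfl, rfl, hadj⟩ := exists_relabel rfl (L.point_injective (by omega))
      (α := .inl v) (β := .inr (e₁, 0)) (x := x) (y := y) (fun j => by
        rw [← not_iff_not]
        refine (hS.ne_iff_mem j).trans ?_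
        simp [hL])
    refine subdivision_isIndContained_of_directed L
      (isIndContained_sup_edge hF (.inl ⟨(L.a_eq e₁ he₁).symm, rfl⟩) fun p q => ?_)
    rw [hadj, L.existsUnique_point_iff (by omega), or_iff_left]
    · simp [hcard]
    · rintro ⟨g, -, -, -, h⟩
      exact hcard (by simp [h])
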